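/- Let $k,\mu,\nu\in\mathbb{C}$ be such that neither $\mu$ nor $\nu$ is a negative integer and $\mu+\nu$ is not a nonpositive integer. Write $(c)_g=\Gamma(c+g)/\Gamma(c)$, and let ${}_pF_q(a_1,\dots,a_p;b_1,\dots,b_q;z)=\sum_{n\ge 0}\frac{(a_1)_n\cdots(a_p)_n}{(b_1)_n\cdots(b_q)_n}\frac{z^n}{n!}$ be the generalized hypergeometric function. Then $$ \begin{aligned} &{}_2F_3\left(\tfrac12,\tfrac{\mu}{2}+\tfrac{\nu}{2}+\tfrac12;\mu+1,\nu+1,\mu+\nu+1;-k^2\right)\\ &=\frac{2^{\mu+\nu}\,\Gamma(\mu+1)\Gamma(\nu+1)\Gamma\left(\frac{\mu}{2}+\frac{\nu}{2}+1\right)}{\sqrt{\pi}\,\Gamma\left(\frac{\mu}{2}+\frac{\nu}{2}\right)^2\Gamma\left(\frac{\mu}{2}+\frac{\nu}{2}+\frac12\right)}\\ &\quad\times\sum_{L=0}^{\infty}\frac{(-1)^{2L}k^{4L}\,2^{4L-2\left(\frac{\mu}{2}+\frac{\nu}{2}\right)-\mu-\nu+1}\left(\left(\frac{\mu}{2}+\frac{\nu}{2}+\frac12\right)_{2L}\right)^2\Gamma(2L+\mu+\nu)}{(2L)!\,\left(L+\frac12\right)_{\mu+\frac12}\left(L+\frac12\right)_{\nu+\frac12}\left(2L+\frac{\mu}{2}+\frac{\nu}{2}\right)\left((\mu+\nu)_{2L}\right)^2\left((2L+\mu+\nu)_{2L}\right)^2}\\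 &\qquad\times{}_1F_2\left(L+\tfrac12;L+\mu+1,2L+\tfrac{\mu}{2}+\tfrac{\nu}{2}+1;-\tfrac{k^2}{4}\right)\,{}_1F_2\left(L+\tfrac12;2L+\tfrac{\mu}{2}+\tfrac{\nu}{2}+1,L+\nu+1;-\tfrac{k^2}{4}\right), \end{aligned} $$ where the series over $L$ converges absolutely (and $k^{0}=1$ also for $k=0$). -/

import Mathlib

open Complex

/-- The generalized hypergeometric function `pFq(a; b; z)`, with upper parameters `a` and lower
parameters `b`, as the sum of its power series
`∑ₙ (∏ᵢ (aᵢ)ₙ) / ((∏ⱼ (bⱼ)ₙ) n!) zⁿ`.  It is meaningful when no lower parameter is a nonpositive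
integer; for `p ≤ q` the series then converges for every complex `z`. -/
noncomputable def genHyp (a b : Multiset ℂ) (z : ℂ) : ℂ :=
  ∑' n : ℕ, (a.map fun c => (ascPochhammer ℂ n).eval c).prod /
    ((b.map fun c => (ascPochhammer ℂ n).eval c).prod * (n.factorial : ℂ)) * z ^ n

/-- The Pochhammer symbol `(c)_g = Γ(c + g) / Γ(c)` with a complex index `g`. -/
noncomputable def poch (c g : ℂ) : ℂ := Gamma (c + g) / Gamma c

/-- For a natural index, `poch` is the rising factorial. -/
theorem poch_natCast (c : ℂ) (n : ℕ) (hc : ∀ m : ℕ, c ≠ -m) :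
    poch c n = (ascPochhammer ℂ n).eval c :=
  Gamma_add_nat_div_Gamma_eq c hc

/-- `genHyp` is the regularized hypergeometric function of Mathlib multiplied by the Gamma values
at the lower parameters. -/
theorem genHyp_eq_regularizedHGFun (a b : Multiset ℂ) (hb : ∀ c ∈ b, ∀ m : ℕ, c ≠ -m) (z : ℂ) :
    genHyp a b z = (b.map Gamma).prod * regularizedHGFun a b z := by
  have key : ∀ n : ℕ, (b.map fun c => Gamma (c + n)).prod =
      (b.map Gamma).prod * (b.map fun c => (ascPochhammer ℂ n).eval c).prod := by
    intro n
    rw [← Multiset.prod_map_mul]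
    congr 1
    refine Multiset.map_congr rfl fun c hc => ?_
    rw [← Gamma_add_nat_div_Gamma_eq c (hb c hc), mul_div_cancel₀ _ (Gamma_ne_zero (hb c hc))]
  have h0 : (b.map Gamma).prod ≠ 0 := by
    rw [Ne, Multiset.prod_eq_zero_iff, Multiset.mem_map]
    rintro ⟨c, hc, h⟩
    exact Gamma_ne_zero (hb c hc) h
  unfold genHyp regularizedHGFun regularizedHGFunSeries FormalMultilinearSeries.sum
  rw [← tsum_mul_left]
  refine tsum_congr fun n => ?_
  rw [FormalMultilinearSeries.ofScalars_apply_eq, regularizedHGFunCoeff, key, smul_eq_mul,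
    ← mul_assoc]
  congr 1
  rw [← mul_div_assoc, show (n.factorial : ℂ) * ((b.map Gamma).prod *
    (b.map fun c => (ascPochhammer ℂ n).eval c).prod) = (b.map Gamma).prod *
    ((b.map fun c => (ascPochhammer ℂ n).eval c).prod * (n.factorial : ℂ)) by ring,
    mul_div_mul_left _ _ h0]

/-- The `L`-th term of the series of products of two `₁F₂` functions. -/
noncomputable def productTerm (k μ ν : ℂ) (L : ℕ) : ℂ :=
  ((-1) ^ (2 * L) * k ^ (4 * L) *
      (2 : ℂ) ^ (4 * (L : ℂ) - 2 * (μ / 2 + ν / 2) - μ - ν + 1) *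
      poch (μ / 2 + ν / 2 + 1 / 2) (2 * L) ^ 2 * Gamma (2 * L + μ + ν)) /
    (((2 * L).factorial : ℂ) * poch (L + 1 / 2) (μ + 1 / 2) * poch (L + 1 / 2) (ν + 1 / 2) *
      (2 * L + μ / 2 + ν / 2) * poch (μ + ν) (2 * L) ^ 2 *
      poch (2 * L + μ + ν) (2 * L) ^ 2) *
    genHyp {(L : ℂ) + 1 / 2} {(L : ℂ) + μ + 1, 2 * (L : ℂ) + μ / 2 + ν / 2 + 1} (-k ^ 2 / 4) *
    genHyp {(L : ℂ) + 1 / 2} {2 * (L : ℂ) + μ / 2 + ν / 2 + 1, (L : ℂ) + ν + 1} (-k ^ 2 / 4)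

/-! Put `a = (μ + ν) / 2` and `z = -k² / 4`. For `Re a > -1/2`, the normalized measure `(1 - x²)^(a
- 1/2) dx` on `[-1, 1]` has moments `∫ x^(2n) = (1/2)ₙ / (a + 1)ₙ`. Both sides of the identity
compute the integral of `₀F₁(; μ + 1; z x²) ₀F₁(; ν + 1; z x²)`, a product of two Bessel functions
up to elementary factors. Multiplying the series and integrating termwise gives the `₂F₃`. Expanding
each factor in the even Gegenbauer polynomials, orthogonal for this measure, and applying Parseval
gives the sum over `L`; the Gegenbauer coefficients are the `₁F₂`.

The proof uses no integral, so it covers every admissible complex `a`. Parseval for monomials is the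
finite identity `sum_range_gegenbauer`, proved by telescoping; the product of the `₀F₁` is
Chu–Vandermonde (`sum_antidiagonal_inv_risingFactorial`). Factorial bounds make the triple series
over `(L, p, q)` absolutely convergent, so it may be summed in either order
(`hasSum_genHyp_gegenbauer_expansion`). `prefactor_eq` matches the constants. -/

/-! ### Rising factorials. -/

/-- The rising factorial `c (c + 1) ⋯ (c + n - 1)`. -/
noncomputable def risingFactorial (c : ℂ) (n : ℕ) : ℂ := (ascPochhammer ℂ n).eval c

theorem risingFactorial_zero (c : ℂ) : risingFactorial c 0 = 1 := by simp [risingFactorial]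

theorem risingFactorial_succ (c : ℂ) (n : ℕ) :
    risingFactorial c (n + 1) = risingFactorial c n * (c + n) :=
  ascPochhammer_succ_eval n c

theorem risingFactorial_ne_zero {c : ℂ} (hc : ∀ m : ℕ, c ≠ -m) (n : ℕ) :
    risingFactorial c n ≠ 0 := by
  induction n with
  | zero => simp [risingFactorial_zero]
  | succ n ih =>
    rw [risingFactorial_succ]
    exact mul_ne_zero ih fun h => hc n (eq_neg_of_add_eq_zero_left h)

theorem risingFactorial_add (c : ℂ) (m n : ℕ) :
    risingFactorial c (m + n) = risingFactorial c m * risingFactorial (c + m) n := by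
  induction n with
  | zero => simp [risingFactorial_zero]
  | succ n ih =>
    rw [← add_assoc, risingFactorial_succ, ih, risingFactorial_succ]
    push_cast; ring

theorem risingFactorial_succ_left (c : ℂ) (n : ℕ) :
    risingFactorial c (n + 1) = c * risingFactorial (c + 1) n := by
  rw [add_comm n 1, risingFactorial_add, risingFactorial_succ, risingFactorial_zero]
  simp

theorem risingFactorial_two_mul (c : ℂ) (n : ℕ) :
    risingFactorial (2 * c) (2 * n) =
      4 ^ n * risingFactorial c n * risingFactorial (c + 1 / 2) n := by
  induction n with
  | zero => simp [risingFactorial_zero]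
  | succ n ih =>
    rw [show 2 * (n + 1) = 2 * n + 1 + 1 by ring, risingFactorial_succ, risingFactorial_succ, ih,
      risingFactorial_succ, risingFactorial_succ]
    push_cast; ring

theorem risingFactorial_one (n : ℕ) : risingFactorial 1 n = n.factorial :=
  ascPochhammer_eval_one ℂ n

theorem factorial_two_mul_eq (n : ℕ) :
    ((2 * n).factorial : ℂ) = 4 ^ n * risingFactorial (1 / 2) n * n.factorial := by
  have h := risingFactorial_two_mul (1 / 2) n
  rw [mul_one_div_cancel two_ne_zero, add_halves, risingFactorial_one, risingFactorial_one] at h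
  exact h

theorem Gamma_add_natCast {c : ℂ} (hc : ∀ m : ℕ, c ≠ -m) (n : ℕ) :
    Gamma (c + n) = Gamma c * risingFactorial c n := by
  rw [risingFactorial, ← Gamma_add_nat_div_Gamma_eq c hc, mul_div_cancel₀ _ (Gamma_ne_zero hc)]

theorem half_ne_neg_natCast (m : ℕ) : (1 / 2 : ℂ) ≠ -m := by
  intro h
  have := congrArg Complex.re h
  simp at this
  have hm : (0 : ℝ) ≤ m := m.cast_nonneg
  linarith

theorem add_natCast_ne {c : ℂ} (hc : ∀ m : ℕ, c ≠ -m) (n m : ℕ) : c + n ≠ -m := fun h =>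
  hc (m + n) (by push_cast; linear_combination h)

theorem ne_neg_natCast_of_two_mul {a : ℂ} (ha : ∀ m : ℕ, 2 * a ≠ -m) (m : ℕ) : a ≠ -m := fun h =>
  ha (2 * m) (by push_cast; linear_combination 2 * h)

theorem add_half_ne_neg_natCast_of_two_mul {a : ℂ} (ha : ∀ m : ℕ, 2 * a ≠ -m) (m : ℕ) :
    a + 1 / 2 ≠ -m := fun h =>
  ha (2 * m + 1) (by push_cast; linear_combination 2 * h)

theorem descFactorial_succ_cast (q l : ℕ) :
    (q.descFactorial (l + 1) : ℂ) = (q - l) * q.descFactorial l := by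
  rw [Nat.descFactorial_succ]
  rcases le_or_gt l q with h | h
  · push_cast [Nat.cast_sub h]; ring
  · simp [Nat.descFactorial_of_lt h]

/-- The Chu–Vandermonde identity for rising factorials. -/
theorem sum_antidiagonal_choose_mul_risingFactorial (r s : ℂ) (n : ℕ) :
    ∑ ij ∈ Finset.HasAntidiagonal.antidiagonal n, (n.choose ij.1 : ℂ) *
      (risingFactorial (r - ij.1 + 1) ij.1 * risingFactorial (s - ij.2 + 1) ij.2) =
      risingFactorial (r + s - n + 1) n := by
  have h := Ring.descPochhammer_smeval_add n (Commute.all r s)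
  simp only [Polynomial.descPochhammer_smeval_eq_ascPochhammer, Polynomial.ascPochhammer_smeval_eq_eval]
    at h
  exact h.symm

/-! ### Parseval for even monomials in Gegenbauer polynomials. -/

/-- The weights in the Parseval identity for even Gegenbauer polynomials. -/
noncomputable def gegenbauerWeight (a : ℂ) (L : ℕ) : ℂ :=
  risingFactorial a L * risingFactorial (a + 1 / 2) L * (2 * L + a) /
    (a * L.factorial * risingFactorial (1 / 2) L)

/-- The coefficient of `x ^ (2 * p)` along the Gegenbauer polynomial of degree `2 * L`,
up to normalization. -/
noncomputable def gegenbauerCoeff (a : ℂ) (p L : ℕ) : ℂ :=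
  p.descFactorial L * risingFactorial (1 / 2) p / risingFactorial (a + 1) (p + L)

/-- The moments satisfy `(a + 1 + p + q) m_(p+q+1) = (1/2 + p + q) m_(p+q)`. The defect of this
recurrence for the partial Parseval sums has a closed form, of Gosper type, verified by induction on
`n`. -/
theorem sum_range_gegenbauer_telescope {a : ℂ} (ha : ∀ m : ℕ, 2 * a ≠ -m) (p q n : ℕ) :
    ∑ L ∈ Finset.range (n + 1), gegenbauerWeight a L * gegenbauerCoeff a p L *
      ((a + 1 + p + q) * gegenbauerCoeff a (q + 1) L -
        (1 / 2 + p + q) * gegenbauerCoeff a q L) =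
    -(risingFactorial a (n + 1) * risingFactorial (a + 1 / 2) (n + 1) /
        (a * n.factorial * risingFactorial (1 / 2) n)) *
      (p.descFactorial (n + 1) * risingFactorial (1 / 2) p / risingFactorial (a + 1) (p + n)) *
      (q.descFactorial n * risingFactorial (1 / 2) q / risingFactorial (a + 1) (q + n + 1)) := by
  have h0 := ne_neg_natCast_of_two_mul ha
  have ha0 : a ≠ 0 := by simpa using h0 0
  have h1 : ∀ m : ℕ, a + 1 ≠ -m := by simpa using add_natCast_ne h0 1
  have hF : ∀ n : ℕ, (n.factorial : ℂ) ≠ 0 := fun n => by exact_mod_cast n.factorial_ne_zero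
  have hr := risingFactorial_ne_zero h1
  have hh := risingFactorial_ne_zero half_ne_neg_natCast
  have hs : ∀ m : ℕ, a + 1 + m ≠ 0 := fun m h => h1 m (eq_neg_of_add_eq_zero_left h)
  induction n with
  | zero =>
    have := hs q
    have := hr p
    have := hr q
    simp only [zero_add, Finset.sum_range_one, gegenbauerWeight, gegenbauerCoeff,
      risingFactorial_zero, add_zero, Nat.descFactorial_zero, Nat.descFactorial_one,
      risingFactorial_succ, Nat.factorial_zero]
    push_cast
    field_simp
    ring
  | succ l ih =>
    rw [Finset.sum_range_succ, ih]
    have e1 := hs (q + l)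
    have e1' := hs (q + l + 1)
    have e2 := hs (p + l)
    have e3 := hr (p + l)
    have e4 := hr (q + l)
    have e5 := hh l
    have e6 := hF l
    have e7 : (l : ℂ) + 1 ≠ 0 := by exact_mod_cast l.succ_ne_zero
    have e8 : (1 : ℂ) + l * 2 ≠ 0 := by norm_cast; omega
    simp only [gegenbauerWeight, gegenbauerCoeff]
    rw [show q + 1 + (l + 1) = q + l + 1 + 1 by ring, show q + (l + 1) = q + l + 1 by ring,
      show p + (l + 1) = p + l + 1 by ring, Nat.succ_descFactorial_succ,
      descFactorial_succ_cast p (l + 1), descFactorial_succ_cast q l]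
    simp only [risingFactorial_succ, Nat.factorial_succ]
    push_cast at e1 e1' e2 ⊢
    generalize risingFactorial (a + 1) (p + l) = A at *
    generalize risingFactorial (a + 1) (q + l) = B at *
    generalize risingFactorial (1 / 2) p = C at *
    generalize risingFactorial (1 / 2) q = D at *
    generalize risingFactorial (1 / 2) l = E at *
    generalize risingFactorial a l = F at *
    generalize risingFactorial (a + 1 / 2) l = G at *
    generalize (p.descFactorial (l + 1) : ℂ) = I at *
    generalize (q.descFactorial l : ℂ) = J at *
    generalize (l.factorial : ℂ) = K at *
    field_simp
    ring

/-- The Parseval identity for the expansions of even monomials in Gegenbauer polynomials, a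
terminating case of Dougall's summation of a very well-poised `₅F₄`. -/
theorem sum_range_gegenbauer {a : ℂ} (ha : ∀ m : ℕ, 2 * a ≠ -m) (p q n : ℕ) (hn : q < n) :
    ∑ L ∈ Finset.range n, gegenbauerWeight a L * gegenbauerCoeff a p L * gegenbauerCoeff a q L =
      risingFactorial (1 / 2) (p + q) / risingFactorial (a + 1) (p + q) := by
  have h0 := ne_neg_natCast_of_two_mul ha
  have ha0 : a ≠ 0 := by simpa using h0 0
  have h1 : ∀ m : ℕ, a + 1 ≠ -m := by simpa using add_natCast_ne h0 1
  have hs : ∀ m : ℕ, a + 1 + m ≠ 0 := fun m h => h1 m (eq_neg_of_add_eq_zero_left h)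
  induction q with
  | zero =>
    rw [Finset.sum_eq_single_of_mem 0 (by simpa using hn)]
    · simp [gegenbauerWeight, gegenbauerCoeff, risingFactorial_zero, ha0]
    · intro L _ hL
      have : (0 : ℕ).descFactorial L = 0 := Nat.descFactorial_of_lt (Nat.pos_of_ne_zero hL)
      simp [gegenbauerCoeff, this]
  | succ q ih =>
    obtain ⟨n, rfl⟩ : ∃ k, n = k + 1 := ⟨n - 1, by omega⟩
    have ht := sum_range_gegenbauer_telescope ha p q n
    -- The boundary term contains `q.descFactorial n`, which vanishes because `q < n`, so the
    -- recurrence is exact.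
    rw [Nat.descFactorial_of_lt (show q < n by omega)] at ht
    have key : (a + 1 + p + q) * ∑ L ∈ Finset.range (n + 1),
        gegenbauerWeight a L * gegenbauerCoeff a p L * gegenbauerCoeff a (q + 1) L =
        (1 / 2 + p + q) * ∑ L ∈ Finset.range (n + 1),
        gegenbauerWeight a L * gegenbauerCoeff a p L * gegenbauerCoeff a q L := by
      rw [← sub_eq_zero, Finset.mul_sum, Finset.mul_sum, ← Finset.sum_sub_distrib]
      refine (Finset.sum_congr rfl fun L _ => ?_).trans (ht.trans (by simp))
      ring
    rw [ih (by omega)] at key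
    have e := hs (p + q)
    push_cast at e
    have e' := risingFactorial_ne_zero h1 (p + q)
    rw [← add_assoc, risingFactorial_succ, risingFactorial_succ]
    rw [← mul_right_inj' (show a + 1 + p + q ≠ 0 by rwa [add_assoc]), key]
    push_cast
    field_simp
    ring

/-! ### Product of two `₀F₁` series. -/

/-- The Chu–Vandermonde identity in the form of a Cauchy product of two `₀F₁` series. -/
theorem sum_antidiagonal_inv_risingFactorial {r s : ℂ} (hr : ∀ m : ℕ, r ≠ -m)
    (hs : ∀ m : ℕ, s ≠ -m) (n : ℕ) :
    ∑ ij ∈ Finset.HasAntidiagonal.antidiagonal n,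
      (1 / (ij.1.factorial * risingFactorial r ij.1) : ℂ) *
        (1 / (ij.2.factorial * risingFactorial s ij.2)) =
      risingFactorial (r + s + n - 1) n /
        (n.factorial * risingFactorial r n * risingFactorial s n) := by
  have hF : ∀ n : ℕ, (n.factorial : ℂ) ≠ 0 := fun n => by exact_mod_cast n.factorial_ne_zero
  have hr' := risingFactorial_ne_zero hr
  have hs' := risingFactorial_ne_zero hs
  -- With these arguments the factors become `(s + j)ᵢ` and `(r + i)ⱼ`, the quotients `(s)ₙ / (s)ⱼ`
  -- and `(r)ₙ / (r)ᵢ`.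
  have h := sum_antidiagonal_choose_mul_risingFactorial (s + n - 1) (r + n - 1) n
  rw [show s + n - 1 + (r + n - 1) - n + 1 = r + s + n - 1 by ring] at h
  rw [← h, Finset.sum_div]
  refine Finset.sum_congr rfl fun ij hij => ?_
  obtain ⟨i, j⟩ := ij
  obtain rfl : i + j = n := by simpa using hij
  have e1 : risingFactorial s (i + j) = risingFactorial s j * risingFactorial (s + j) i := by
    rw [add_comm, risingFactorial_add]
  have e2 := risingFactorial_add r i j
  have e3 : ((i + j).factorial : ℂ) = (i + j).choose i * i.factorial * j.factorial := by
    rw [Nat.choose_symm_add]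
    exact_mod_cast (Nat.add_choose_mul_factorial_mul_factorial i j).symm
  have e4 : ((i + j).choose i : ℂ) ≠ 0 := fun h0 => hF (i + j) (by rw [e3, h0]; ring)
  have e5 := hs' (i + j)
  have e6 := hr' (i + j)
  have e7 := hr' i
  have e8 := hs' j
  rw [e1] at e5
  rw [e2] at e6
  have e9 := right_ne_zero_of_mul e5
  have e10 := right_ne_zero_of_mul e6
  have := hF i
  have := hF j
  simp only
  rw [e1, e2, e3]
  push_cast
  rw [show s + (i + j) - 1 - i + 1 = s + j by ring, show r + (i + j) - 1 - j + 1 = r + i by ring]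
  field_simp

/-! ### Growth estimates and absolute convergence. -/

theorem norm_risingFactorial_le (c : ℂ) (n : ℕ) :
    ‖risingFactorial c n‖ ≤ (‖c‖ + 1) ^ n * n.factorial := by
  induction n with
  | zero => simp [risingFactorial_zero]
  | succ n ih =>
    rw [risingFactorial_succ, norm_mul, Nat.factorial_succ, pow_succ]
    have h : ‖c + n‖ ≤ (‖c‖ + 1) * (n + 1) := by
      refine (norm_add_le _ _).trans ?_
      rw [Complex.norm_natCast]
      nlinarith [mul_nonneg (norm_nonneg c) (Nat.cast_nonneg (α := ℝ) n)]
    calc _ ≤ ((‖c‖ + 1) ^ n * n.factorial) * ((‖c‖ + 1) * (n + 1)) := by gcongr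
      _ = _ := by push_cast; ring

theorem exists_factorial_le_pow_mul_norm_risingFactorial {c : ℂ} (hc : ∀ m : ℕ, c ≠ -m) :
    ∃ K : ℝ, 0 < K ∧ ∀ n : ℕ, (n.factorial : ℝ) ≤ K ^ n * ‖risingFactorial c n‖ := by
  -- The ratios `(j + 1) / (c + j)` of successive factors converge, hence are bounded; `K` is a
  -- bound for their norms.
  have ht := ((tendsto_natCast_div_add_atTop (c - 1)).comp (Filter.tendsto_add_atTop_nat 1)).norm
  obtain ⟨K, hK⟩ := ht.bddAbove_range
  have hK' : ∀ j : ℕ, (j + 1 : ℝ) ≤ K * ‖c + j‖ := by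
    intro j
    have h0 : c + j ≠ 0 := fun h => hc j (eq_neg_of_add_eq_zero_left h)
    have h1 := hK (Set.mem_range_self j)
    simp only [Function.comp] at h1
    rw [show ((j + 1 : ℕ) : ℂ) + (c - 1) = c + j by push_cast; ring, norm_div,
      Complex.norm_natCast, div_le_iff₀ (norm_pos_iff.mpr h0)] at h1
    exact_mod_cast h1
  have hK0 : 0 < K := by
    have h := hK' 0
    by_contra! hneg
    have := mul_nonpos_of_nonpos_of_nonneg hneg (norm_nonneg (c + (0 : ℕ)))
    push_cast at h this
    linarith
  refine ⟨K, hK0, fun n => ?_⟩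
  induction n with
  | zero => simp [risingFactorial_zero]
  | succ n ih =>
    rw [risingFactorial_succ, norm_mul, Nat.factorial_succ]
    calc (((n + 1) * n.factorial : ℕ) : ℝ) = (n + 1) * n.factorial := by push_cast; ring
      _ ≤ (K * ‖c + n‖) * (K ^ n * ‖risingFactorial c n‖) := by
        gcongr
        exact hK' n
      _ = _ := by ring

/-- The contribution of the `p`-th term of the power series of `₀F₁(;μ + 1; z x²)` to its
coefficient along the Gegenbauer polynomial of degree `2 * L`. -/
noncomputable def besselCoeff (z a μ : ℂ) (p L : ℕ) : ℂ :=
  z ^ p * (1 / (p.factorial * risingFactorial (μ + 1) p)) * gegenbauerCoeff a p L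

/-- The coefficient vanishes for `p < L`. Writing `p = L + m`, the falling factorial cancels against
`p!` and leaves `m!`. -/
theorem besselCoeff_add (z a μ : ℂ) (m L : ℕ) :
    besselCoeff z a μ (L + m) L = z ^ (L + m) * risingFactorial (1 / 2) (L + m) /
      (m.factorial * risingFactorial (μ + 1) (L + m) * risingFactorial (a + 1) (L + m + L)) := by
  have hF : ∀ n : ℕ, (n.factorial : ℂ) ≠ 0 := fun n => by exact_mod_cast n.factorial_ne_zero
  have h : (m.factorial : ℂ) * (L + m).descFactorial L = (L + m).factorial := by
    have := Nat.factorial_mul_descFactorial (Nat.le_add_right L m)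
    rw [Nat.add_sub_cancel_left] at this
    exact_mod_cast this
  rw [besselCoeff, gegenbauerCoeff, ← h]
  have h1 := hF m
  have h2 : ((L + m).descFactorial L : ℂ) ≠ 0 := fun h0 => hF (L + m) (by rw [← h, h0, mul_zero])
  field_simp

/-- Up to geometric factors, `(1/2)_(L+m)` cancels against `(μ + 1)_(L+m)`, while `(a + 1)_(2L+m)`
is at least of size `(2L + m)! ≥ L!`. -/
theorem exists_norm_besselCoeff_add_le (z : ℂ) {a μ : ℂ} (ha : ∀ m : ℕ, a + 1 ≠ -m)
    (hμ : ∀ m : ℕ, μ + 1 ≠ -m) :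
    ∃ X Y : ℝ, 0 ≤ X ∧ 0 ≤ Y ∧ ∀ L m : ℕ,
      ‖besselCoeff z a μ (L + m) L‖ ≤ Y ^ L / L.factorial * (X ^ m / m.factorial) := by
  obtain ⟨K, hK0, hK⟩ := exists_factorial_le_pow_mul_norm_risingFactorial hμ
  obtain ⟨K', hK0', hK'⟩ := exists_factorial_le_pow_mul_norm_risingFactorial ha
  set D := ‖(1 / 2 : ℂ)‖ + 1 with hD
  have hD0 : 0 ≤ D := by positivity
  refine ⟨‖z‖ * D * K * K', ‖z‖ * D * K * K' * K', by positivity, by positivity, fun L m => ?_⟩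
  have b0 := norm_risingFactorial_le (1 / 2) (L + m)
  have b1 := hK (L + m)
  have b2 := hK' (L + m + L)
  have p1 : 0 < ‖risingFactorial (μ + 1) (L + m)‖ :=
    norm_pos_iff.mpr (risingFactorial_ne_zero hμ _)
  have p2 : 0 < ‖risingFactorial (a + 1) (L + m + L)‖ :=
    norm_pos_iff.mpr (risingFactorial_ne_zero ha _)
  have b3 : (L.factorial : ℝ) ≤ (L + m + L).factorial := by
    exact_mod_cast Nat.factorial_le (by omega)
  have f1 : (0 : ℝ) < (L + m).factorial := by exact_mod_cast (L + m).factorial_pos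
  have f2 : (0 : ℝ) < L.factorial := by exact_mod_cast L.factorial_pos
  have f3 : (0 : ℝ) < m.factorial := by exact_mod_cast m.factorial_pos
  rw [besselCoeff_add, norm_div, norm_mul, norm_mul, norm_mul, norm_pow, Complex.norm_natCast,
    div_mul_div_comm, div_le_div_iff₀ (by positivity) (by positivity)]
  calc _ ≤ ‖z‖ ^ (L + m) * (D ^ (L + m) * (L + m).factorial) *
        ((L + m + L).factorial * m.factorial) := by gcongr
    _ ≤ ‖z‖ ^ (L + m) * (D ^ (L + m) * (K ^ (L + m) * ‖risingFactorial (μ + 1) (L + m)‖)) *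
        (K' ^ (L + m + L) * ‖risingFactorial (a + 1) (L + m + L)‖ * m.factorial) := by gcongr
    _ = _ := by simp only [pow_add, mul_pow]; ring

theorem exists_norm_gegenbauerWeight_le (a : ℂ) :
    ∃ C Z : ℝ, 0 ≤ C ∧ 0 ≤ Z ∧ ∀ L : ℕ, ‖gegenbauerWeight a L‖ ≤ C * Z ^ L := by
  obtain ⟨K, hK0, hK⟩ := exists_factorial_le_pow_mul_norm_risingFactorial half_ne_neg_natCast
  -- For `a = 0` both the weight and the constant are zero, by the convention for division by zero.
  refine ⟨(2 + ‖a‖) * ‖a‖⁻¹, (‖a‖ + 1) * (‖a + 1 / 2‖ + 1) * K * 2, by positivity, by positivity,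
    fun L => ?_⟩
  have b1 := norm_risingFactorial_le a L
  have b2 := norm_risingFactorial_le (a + 1 / 2) L
  have p1 : 0 < ‖risingFactorial (1 / 2) L‖ :=
    norm_pos_iff.mpr (risingFactorial_ne_zero half_ne_neg_natCast _)
  have f1 : (0 : ℝ) < L.factorial := by exact_mod_cast L.factorial_pos
  have b3 : ‖2 * (L : ℂ) + a‖ ≤ (2 + ‖a‖) * 2 ^ L := by
    have h2 : (L + 1 : ℝ) ≤ 2 ^ L := by exact_mod_cast L.lt_two_pow_self
    calc ‖2 * (L : ℂ) + a‖ ≤ ‖2 * (L : ℂ)‖ + ‖a‖ := norm_add_le _ _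
      _ = 2 * L + ‖a‖ := by simp
      _ ≤ (2 + ‖a‖) * (L + 1) := by
        nlinarith [mul_nonneg (norm_nonneg a) (Nat.cast_nonneg (α := ℝ) L)]
      _ ≤ _ := by gcongr
  have e : ‖gegenbauerWeight a L‖ = ‖risingFactorial a L‖ * ‖risingFactorial (a + 1 / 2) L‖ *
      ‖2 * (L : ℂ) + a‖ * ‖a‖⁻¹ / (L.factorial * ‖risingFactorial (1 / 2) L‖) := by
    rw [gegenbauerWeight, norm_div, norm_mul, norm_mul, norm_mul, norm_mul, Complex.norm_natCast,
      mul_assoc ‖a‖, ← div_div, div_eq_mul_inv _ ‖a‖]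
  rw [e, div_le_iff₀ (by positivity)]
  calc _ ≤ ((‖a‖ + 1) ^ L * L.factorial) * ((‖a + 1 / 2‖ + 1) ^ L * L.factorial) *
        ((2 + ‖a‖) * 2 ^ L) * ‖a‖⁻¹ := by gcongr
    _ ≤ ((‖a‖ + 1) ^ L * L.factorial) *
        ((‖a + 1 / 2‖ + 1) ^ L * (K ^ L * ‖risingFactorial (1 / 2) L‖)) *
        ((2 + ‖a‖) * 2 ^ L) * ‖a‖⁻¹ := by gcongr; exact hK L
    _ = _ := by simp only [mul_pow]; ring

theorem summable_besselCoeff_add (z : ℂ) {a μ : ℂ} (ha : ∀ m : ℕ, a + 1 ≠ -m)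
    (hμ : ∀ m : ℕ, μ + 1 ≠ -m) (L : ℕ) :
    Summable fun m => ‖besselCoeff z a μ (L + m) L‖ := by
  obtain ⟨X, Y, _, _, h⟩ := exists_norm_besselCoeff_add_le z ha hμ
  exact Summable.of_nonneg_of_le (fun _ => norm_nonneg _) (h L)
    ((Real.summable_pow_div_factorial X).mul_left _)

theorem summable_gegenbauer_expansion_add (z : ℂ) {a μ ν : ℂ} (ha : ∀ m : ℕ, a + 1 ≠ -m)
    (hμ : ∀ m : ℕ, μ + 1 ≠ -m) (hν : ∀ m : ℕ, ν + 1 ≠ -m) :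
    Summable fun x : ℕ × ℕ × ℕ => gegenbauerWeight a x.1 *
      (besselCoeff z a μ (x.1 + x.2.1) x.1 * besselCoeff z a ν (x.1 + x.2.2) x.1) := by
  obtain ⟨X, Y, hX, hY, h⟩ := exists_norm_besselCoeff_add_le z ha hμ
  obtain ⟨X', Y', hX', hY', h'⟩ := exists_norm_besselCoeff_add_le z ha hν
  obtain ⟨C, Z, hC, hZ, hW⟩ := exists_norm_gegenbauerWeight_le a
  have hs := ((Real.summable_pow_div_factorial (Z * Y * Y')).mul_of_nonneg
    ((Real.summable_pow_div_factorial X).mul_of_nonneg (Real.summable_pow_div_factorial X')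
      (fun n => by positivity) (fun n => by positivity)) (fun n => by positivity)
      (fun n => by positivity)).mul_left C
  refine Summable.of_norm_bounded hs fun x => ?_
  obtain ⟨L, m, n⟩ := x
  have f : (1 : ℝ) ≤ L.factorial := by exact_mod_cast L.factorial_pos
  -- One factor `1 / L!` already beats the geometric growth in `L`, so the second is discarded.
  have h'' : ‖besselCoeff z a ν (L + n) L‖ ≤ Y' ^ L * (X' ^ n / n.factorial) :=
    (h' L n).trans (by gcongr; exact div_le_self (by positivity) f)
  simp only [norm_mul]
  calc _ ≤ C * Z ^ L * ((Y ^ L / L.factorial * (X ^ m / m.factorial)) *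
        (Y' ^ L * (X' ^ n / n.factorial))) := by
        gcongr
        · exact hW L
        · exact h L m
    _ = _ := by simp only [mul_pow]; ring

/-! ### The two orders of summation. -/

theorem tsum_besselCoeff_add (z a μ : ℂ) (L : ℕ) :
    ∑' m, besselCoeff z a μ (L + m) L =
      z ^ L * risingFactorial (1 / 2) L /
        (risingFactorial (μ + 1) L * risingFactorial (a + 1) (2 * L)) *
      genHyp {(L : ℂ) + 1 / 2} {(L : ℂ) + μ + 1, 2 * (L : ℂ) + a + 1} z := by
  rw [genHyp, ← tsum_mul_left]
  refine tsum_congr fun m => ?_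
  simp only [Multiset.map_singleton, Multiset.prod_singleton, Multiset.insert_eq_cons,
    Multiset.map_cons, Multiset.prod_cons]
  rw [besselCoeff_add, show L + m + L = 2 * L + m by ring, risingFactorial_add,
    risingFactorial_add (μ + 1), risingFactorial_add (a + 1),
    show (1 / 2 : ℂ) + L = L + 1 / 2 by ring, show μ + 1 + L = L + μ + 1 by ring,
    show a + 1 + ((2 * L : ℕ) : ℂ) = 2 * L + a + 1 by push_cast; ring, pow_add]
  simp only [← risingFactorial.eq_def]
  ring

/-- By Parseval the sum over `L` depends on `p + q = n` only, so the Cauchy product of the `₀F₁`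
factors out. Duplication of `(2a + 1)_(2n)` then cancels `(a + 1)ₙ` and turns `z` into `4 z`. -/
theorem sum_antidiagonal_gegenbauer_expansion (z : ℂ) {a μ ν : ℂ} (ha : ∀ m : ℕ, 2 * a ≠ -m)
    (hμ : ∀ m : ℕ, μ + 1 ≠ -m) (hν : ∀ m : ℕ, ν + 1 ≠ -m) (hsum : μ + ν = 2 * a) (n : ℕ) :
    ∑ x ∈ Finset.HasAntidiagonal.antidiagonal n,
      ∑' L, gegenbauerWeight a L * (besselCoeff z a μ x.1 L * besselCoeff z a ν x.2 L) =
    risingFactorial (1 / 2) n * risingFactorial (a + 1 / 2) n /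
      (risingFactorial (μ + 1) n * risingFactorial (ν + 1) n * risingFactorial (2 * a + 1) n *
        n.factorial) * (4 * z) ^ n := by
  have key : ∀ x ∈ Finset.HasAntidiagonal.antidiagonal n,
      ∑' L, gegenbauerWeight a L * (besselCoeff z a μ x.1 L * besselCoeff z a ν x.2 L) =
      z ^ n * (risingFactorial (1 / 2) n / risingFactorial (a + 1) n) *
      ((1 / (x.1.factorial * risingFactorial (μ + 1) x.1) : ℂ) *
        (1 / (x.2.factorial * risingFactorial (ν + 1) x.2))) := by
    rintro ⟨p, q⟩ hx
    obtain rfl : p + q = n := by simpa using hx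
    rw [tsum_eq_sum (s := Finset.range (q + 1)), ← sum_range_gegenbauer ha p q _ q.lt_succ_self,
      Finset.mul_sum, Finset.sum_mul]
    · refine Finset.sum_congr rfl fun L _ => ?_
      simp only [besselCoeff, pow_add]
      ring
    · intro L hL
      have : q.descFactorial L = 0 := Nat.descFactorial_of_lt (by simpa using hL)
      simp [besselCoeff, gegenbauerCoeff, this]
  rw [Finset.sum_congr rfl key, ← Finset.mul_sum, sum_antidiagonal_inv_risingFactorial hμ hν,
    show μ + 1 + (ν + 1) + n - 1 = 2 * a + 1 + n by linear_combination hsum]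
  have h0 := ne_neg_natCast_of_two_mul ha
  have h1 : ∀ m : ℕ, a + 1 ≠ -m := by simpa using add_natCast_ne h0 1
  have h2 : ∀ m : ℕ, 2 * a + 1 ≠ -m := by simpa using add_natCast_ne ha 1
  have e := risingFactorial_two_mul (a + 1 / 2) n
  rw [show 2 * (a + 1 / 2) = 2 * a + 1 by ring, two_mul n, risingFactorial_add,
    show a + 1 / 2 + 1 / 2 = a + 1 by ring] at e
  have e1 := risingFactorial_ne_zero h1 n
  have e2 := risingFactorial_ne_zero h2 n
  have e3 := risingFactorial_ne_zero hμ n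
  have e4 := risingFactorial_ne_zero hν n
  have e5 : (n.factorial : ℂ) ≠ 0 := by exact_mod_cast n.factorial_ne_zero
  rw [mul_pow]
  generalize risingFactorial (a + 1 / 2) n = A at *
  field_simp
  linear_combination z ^ n * risingFactorial (1 / 2) n * e

theorem hasSum_genHyp_gegenbauer_expansion (z : ℂ) {a μ ν : ℂ} (ha : ∀ m : ℕ, 2 * a ≠ -m)
    (hμ : ∀ m : ℕ, μ + 1 ≠ -m) (hν : ∀ m : ℕ, ν + 1 ≠ -m) (hsum : μ + ν = 2 * a) :
    HasSum (fun L => gegenbauerWeight a L * ((∑' m, besselCoeff z a μ (L + m) L) *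
      ∑' n, besselCoeff z a ν (L + n) L))
      (genHyp {1 / 2, a + 1 / 2} {μ + 1, ν + 1, 2 * a + 1} (4 * z)) := by
  have h0 := ne_neg_natCast_of_two_mul ha
  have h1 : ∀ m : ℕ, a + 1 ≠ -m := by simpa using add_natCast_ne h0 1
  set f : ℕ × ℕ × ℕ → ℂ := fun x => gegenbauerWeight a x.1 *
    (besselCoeff z a μ x.2.1 x.1 * besselCoeff z a ν x.2.2 x.1) with hf
  -- The range of `i` is `p, q ≥ L`, outside which the terms vanish; shifted indices give the `₁F₂`,
  -- unshifted ones the antidiagonals `p + q = n`.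
  set i : ℕ × ℕ × ℕ → ℕ × ℕ × ℕ := fun x => (x.1, x.1 + x.2.1, x.1 + x.2.2) with hi
  have hinj : Function.Injective i := by
    rintro ⟨L, m, n⟩ ⟨L', m', n'⟩ h
    simp only [hi, Prod.mk.injEq] at h ⊢
    omega
  have hzero : ∀ x, x ∉ Set.range i → f x = 0 := by
    rintro ⟨L, p, q⟩ hx
    by_cases hp : p < L
    · simp [hf, besselCoeff, gegenbauerCoeff, Nat.descFactorial_of_lt hp]
    by_cases hq : q < L
    · simp [hf, besselCoeff, gegenbauerCoeff, Nat.descFactorial_of_lt hq]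
    exact absurd ⟨(L, p - L, q - L), Prod.ext rfl (Prod.ext (Nat.add_sub_of_le (not_lt.mp hp))
      (Nat.add_sub_of_le (not_lt.mp hq)))⟩ hx
  have hs : Summable (f ∘ i) := summable_gegenbauer_expansion_add z h1 hμ hν
  have hsf : Summable f := (hinj.summable_iff hzero).mp hs
  have hin : ∀ L, ∑' c, (f ∘ i) (L, c) = gegenbauerWeight a L *
      ((∑' m, besselCoeff z a μ (L + m) L) * ∑' n, besselCoeff z a ν (L + n) L) := by
    intro L
    rw [tsum_mul_tsum_of_summable_norm (summable_besselCoeff_add z h1 hμ L)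
      (summable_besselCoeff_add z h1 hν L), ← tsum_mul_left]
    rfl
  -- For the `₂F₃` side, `L` becomes the innermost index and the pairs `(p, q)` are grouped by `p +
  -- q`.
  have hsw : Summable (f ∘ Equiv.prodComm (ℕ × ℕ) ℕ) := (Equiv.summable_iff _).mpr hsf
  have hval : ∑' x, (f ∘ i) x =
      genHyp {1 / 2, a + 1 / 2} {μ + 1, ν + 1, 2 * a + 1} (4 * z) := by
    have hsupp : Function.support f ⊆ Set.range i := fun x hx => by
      by_contra hx'
      exact hx (hzero x hx')
    have t1 : ∑' x, (f ∘ i) x = ∑' x, f x := hinj.tsum_eq hsupp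
    rw [t1, ← (Equiv.prodComm (ℕ × ℕ) ℕ).tsum_eq f]
    have t2 := hsw.tsum_prod
    simp only [Function.comp] at t2
    rw [t2, ← Finset.HasAntidiagonal.sigmaAntidiagonalEquivProd.tsum_eq]
    have hsg := Finset.HasAntidiagonal.sigmaAntidiagonalEquivProd.summable_iff.mpr hsw.prod
    refine (hsg.tsum_sigma).trans ?_
    rw [genHyp]
    refine tsum_congr fun n => ?_
    have t3 := sum_antidiagonal_gegenbauer_expansion z ha hμ hν hsum n
    rw [← Finset.tsum_subtype] at t3
    refine t3.trans ?_
    simp only [Multiset.map_singleton, Multiset.prod_singleton, Multiset.insert_eq_cons,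
      Multiset.map_cons, Multiset.prod_cons, risingFactorial]
    ring
  rw [← hval]
  refine (hs.tsum_prod).symm ▸ ?_
  simpa only [hin] using hs.prod.hasSum

/-! ### Matching the constants, and the theorem. -/

theorem prefactor_eq (k μ ν a : ℂ) (ha : ∀ m : ℕ, 2 * a ≠ -m) (hμ : ∀ m : ℕ, μ + 1 ≠ -m)
    (hν : ∀ m : ℕ, ν + 1 ≠ -m) (hsum : μ + ν = 2 * a) (L : ℕ) :
    ((2 : ℂ) ^ (μ + ν) * Gamma (μ + 1) * Gamma (ν + 1) * Gamma (a + 1)) /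
        (((Real.sqrt Real.pi : ℝ) : ℂ) * Gamma a ^ 2 * Gamma (a + 1 / 2)) *
      (((-1) ^ (2 * L) * k ^ (4 * L) * (2 : ℂ) ^ (4 * (L : ℂ) - 2 * a - μ - ν + 1) *
        poch (a + 1 / 2) (2 * L) ^ 2 * Gamma (2 * L + μ + ν)) /
      (((2 * L).factorial : ℂ) * poch (L + 1 / 2) (μ + 1 / 2) * poch (L + 1 / 2) (ν + 1 / 2) *
        (2 * L + a) * poch (μ + ν) (2 * L) ^ 2 * poch (2 * L + μ + ν) (2 * L) ^ 2)) =
    gegenbauerWeight a L *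
      ((-k ^ 2 / 4) ^ L * risingFactorial (1 / 2) L /
        (risingFactorial (μ + 1) L * risingFactorial (a + 1) (2 * L))) *
      ((-k ^ 2 / 4) ^ L * risingFactorial (1 / 2) L /
        (risingFactorial (ν + 1) L * risingFactorial (a + 1) (2 * L))) := by
  have ha' := ne_neg_natCast_of_two_mul ha
  have ha0 : a ≠ 0 := by simpa using ha' 0
  have hah := add_half_ne_neg_natCast_of_two_mul ha
  have h2L : ∀ m : ℕ, 2 * a + (2 * L : ℕ) ≠ -m := add_natCast_ne ha (2 * L)
  have hLa : (2 : ℂ) * L + a ≠ 0 := fun h => ha' (2 * L) (by push_cast; linear_combination h)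
  have s0 : ((Real.sqrt Real.pi : ℝ) : ℂ) ≠ 0 := by
    exact_mod_cast (Real.sqrt_pos.mpr Real.pi_pos).ne'
  have hpoch : ∀ c : ℂ, (∀ m : ℕ, c ≠ -m) → poch c (2 * L) = risingFactorial c (2 * L) := by
    intro c hc
    have h := poch_natCast c (2 * L) hc
    push_cast at h
    exact h
  have hhalf : Gamma (1 / 2) = ((Real.sqrt Real.pi : ℝ) : ℂ) := by
    rw [← Real.Gamma_one_half_eq, ← Complex.Gamma_ofReal]
    push_cast; rfl
  have e1 := hpoch _ hah
  have e2 : Gamma (2 * L + μ + ν) = Gamma (2 * a) * risingFactorial (2 * a) (2 * L) := by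
    rw [← Gamma_add_natCast ha, add_assoc, hsum]
    push_cast; rw [add_comm]
  have e3 : poch (μ + ν) (2 * L) = risingFactorial (2 * a) (2 * L) := by
    rw [hsum, hpoch _ ha]
  have e4 : poch (2 * L + μ + ν) (2 * L) = risingFactorial (2 * a + (2 * L : ℕ)) (2 * L) := by
    rw [← hpoch _ h2L, add_assoc, hsum, add_comm]
    push_cast; rfl
  have e5 : ∀ c : ℂ, (∀ m : ℕ, c + 1 ≠ -m) → poch (L + 1 / 2) (c + 1 / 2) =
      Gamma (c + 1) * risingFactorial (c + 1) L /
        (((Real.sqrt Real.pi : ℝ) : ℂ) * risingFactorial (1 / 2) L) := by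
    intro c hc
    rw [poch, show (L : ℂ) + 1 / 2 + (c + 1 / 2) = c + 1 + L by ring, Gamma_add_natCast hc,
      show (L : ℂ) + 1 / 2 = 1 / 2 + L by ring, Gamma_add_natCast half_ne_neg_natCast,
      hhalf]
  have e6 : (2 : ℂ) ^ (μ + ν) * (2 : ℂ) ^ (4 * (L : ℂ) - 2 * a - μ - ν + 1) =
      (4 ^ L) ^ 2 * (2 : ℂ) ^ (1 - 2 * a) := by
    rw [← cpow_add _ _ two_ne_zero, show μ + ν + (4 * (L : ℂ) - 2 * a - μ - ν + 1) =
      ((4 * L : ℕ) : ℂ) + (1 - 2 * a) by push_cast; ring, cpow_add _ _ two_ne_zero, cpow_natCast,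
      ← pow_mul, show (4 : ℂ) = 2 ^ 2 by norm_num, ← pow_mul]
    congr 2; ring
  have e7 := Gamma_mul_Gamma_add_half a
  have e8 := risingFactorial_two_mul a (2 * L)
  rw [two_mul (2 * L), risingFactorial_add, pow_mul', pow_two] at e8
  have e9 := risingFactorial_two_mul a L
  have e10 : a * risingFactorial (a + 1) (2 * L) = risingFactorial a (2 * L) * (2 * L + a) := by
    rw [← risingFactorial_succ_left, risingFactorial_succ]; push_cast; ring
  have e11 : (-k ^ 2 / 4) ^ L * (-k ^ 2 / 4) ^ L = k ^ (4 * L) / (4 ^ L) ^ 2 := by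
    rw [← mul_pow, pow_mul, ← pow_mul (4 : ℂ), mul_comm L 2, pow_mul (4 : ℂ), ← div_pow]
    congr 1; ring
  have g1 := Gamma_ne_zero hμ
  have g2 := Gamma_ne_zero hν
  have g3 := Gamma_ne_zero ha'
  have g4 := Gamma_ne_zero hah
  have n1 := risingFactorial_ne_zero half_ne_neg_natCast L
  have n2 := risingFactorial_ne_zero hμ L
  have n3 := risingFactorial_ne_zero hν L
  have n4 := risingFactorial_ne_zero ha' (2 * L)
  have n5 := risingFactorial_ne_zero hah (2 * L)
  have n6 := risingFactorial_ne_zero ha (2 * L)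
  have n7 := risingFactorial_ne_zero h2L (2 * L)
  have n8 : (L.factorial : ℂ) ≠ 0 := by exact_mod_cast L.factorial_ne_zero
  have n9 : (2 : ℂ) ^ (1 - 2 * a) ≠ 0 := by simp [cpow_eq_zero_iff]
  have n10 : (4 : ℂ) ^ L ≠ 0 := pow_ne_zero _ (by norm_num)
  have n11 : (2 : ℂ) ^ (μ + ν) ≠ 0 := by simp [cpow_eq_zero_iff]
  have n12 := risingFactorial_ne_zero ha' L
  have n13 := risingFactorial_ne_zero hah L
  -- The duplication formulas are solved for the quantities to be eliminated, so that the remaining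
  -- powers, Gamma values and rising factorials act as independent nonzero atoms.
  have e6' := eq_div_of_mul_eq n11 ((mul_comm _ _).trans e6)
  have e7' := eq_div_of_mul_eq (mul_ne_zero n9 s0) ((mul_assoc _ _ _).symm.trans e7.symm)
  have e8' := eq_div_of_mul_eq n6 ((mul_comm _ _).trans e8)
  have e10' := eq_div_of_mul_eq ha0 ((mul_comm _ _).trans e10)
  have e12 : gegenbauerWeight a L *
      ((-k ^ 2 / 4) ^ L * risingFactorial (1 / 2) L /
        (risingFactorial (μ + 1) L * risingFactorial (a + 1) (2 * L))) *
      ((-k ^ 2 / 4) ^ L * risingFactorial (1 / 2) L /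
        (risingFactorial (ν + 1) L * risingFactorial (a + 1) (2 * L))) =
      gegenbauerWeight a L * (k ^ (4 * L) / (4 ^ L) ^ 2) * risingFactorial (1 / 2) L ^ 2 /
        (risingFactorial (μ + 1) L * risingFactorial (ν + 1) L *
          risingFactorial (a + 1) (2 * L) ^ 2) := by
    rw [← e11]; ring
  rw [e12, gegenbauerWeight, e1, e2, e3, e4, e5 μ hμ, e5 ν hν, Gamma_add_one a ha0, e6', e7', e8',
    e10', e9, factorial_two_mul_eq, Even.neg_one_pow (even_two_mul L)]
  generalize (2 : ℂ) ^ (μ + ν) = t1 at *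
  generalize (2 : ℂ) ^ (1 - 2 * a) = t2 at *
  generalize ((Real.sqrt Real.pi : ℝ) : ℂ) = s at *
  generalize Gamma (a + 1 / 2) = G1 at *
  generalize Gamma a = G2 at *
  generalize risingFactorial (a + 1 / 2) L = A at *
  generalize risingFactorial (a + 1 / 2) (2 * L) = B at *
  generalize risingFactorial (1 / 2) L = C at *
  clear e1 e2 e3 e4 e5 e6 e7 e8 e9 e10 e11 e6' e7' e8' e10' e12
  field_simp

theorem mainTheorem8 (k μ ν : ℂ)
    (hμ : ∀ m : ℕ, μ + 1 ≠ -(m : ℂ))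
    (hν : ∀ m : ℕ, ν + 1 ≠ -(m : ℂ))
    (hμν : ∀ m : ℕ, μ + ν ≠ -(m : ℂ)) :
    Summable (productTerm k μ ν) ∧
      genHyp {1 / 2, μ / 2 + ν / 2 + 1 / 2} {μ + 1, ν + 1, μ + ν + 1} (-k ^ 2) =
        ((2 : ℂ) ^ (μ + ν) * Gamma (μ + 1) * Gamma (ν + 1) * Gamma (μ / 2 + ν / 2 + 1)) /
          (((Real.sqrt Real.pi : ℝ) : ℂ) * Gamma (μ / 2 + ν / 2) ^ 2 *
            Gamma (μ / 2 + ν / 2 + 1 / 2)) *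
          ∑' L : ℕ, productTerm k μ ν L := by
  obtain ⟨a, hadef⟩ : ∃ a, a = μ / 2 + ν / 2 := ⟨_, rfl⟩
  have hsum : μ + ν = 2 * a := by rw [hadef]; ring
  have ha : ∀ m : ℕ, 2 * a ≠ -m := hsum ▸ hμν
  have ha' := ne_neg_natCast_of_two_mul ha
  have ha1 : ∀ m : ℕ, a + 1 ≠ -m := by simpa using add_natCast_ne ha' 1
  have h := hasSum_genHyp_gegenbauer_expansion (-k ^ 2 / 4) ha hμ hν hsum
  set c : ℂ := ((2 : ℂ) ^ (μ + ν) * Gamma (μ + 1) * Gamma (ν + 1) * Gamma (μ / 2 + ν / 2 + 1)) /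
          (((Real.sqrt Real.pi : ℝ) : ℂ) * Gamma (μ / 2 + ν / 2) ^ 2 *
            Gamma (μ / 2 + ν / 2 + 1 / 2)) with hc
  -- Needed to pass from summability of `c * productTerm k μ ν L` to that of `productTerm k μ ν`.
  have hc0 : c ≠ 0 := by
    rw [hc, ← hadef]
    have s0 : ((Real.sqrt Real.pi : ℝ) : ℂ) ≠ 0 := by
      exact_mod_cast (Real.sqrt_pos.mpr Real.pi_pos).ne'
    have n11 : (2 : ℂ) ^ (μ + ν) ≠ 0 := by simp [cpow_eq_zero_iff]
    exact div_ne_zero (mul_ne_zero (mul_ne_zero (mul_ne_zero n11 (Gamma_ne_zero hμ))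
      (Gamma_ne_zero hν)) (Gamma_ne_zero ha1)) (mul_ne_zero (mul_ne_zero s0
      (pow_ne_zero 2 (Gamma_ne_zero ha')))
      (Gamma_ne_zero (add_half_ne_neg_natCast_of_two_mul ha)))
  have hterm : ∀ L, gegenbauerWeight a L * ((∑' m, besselCoeff (-k ^ 2 / 4) a μ (L + m) L) *
      ∑' n, besselCoeff (-k ^ 2 / 4) a ν (L + n) L) = c * productTerm k μ ν L := by
    intro L
    rw [tsum_besselCoeff_add, tsum_besselCoeff_add, productTerm, ← mul_assoc c, ← mul_assoc c, hc, ← hadef,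
      show 2 * (L : ℂ) + μ / 2 + ν / 2 = 2 * L + a by rw [hadef]; ring,
      Multiset.pair_comm (2 * (L : ℂ) + a + 1), prefactor_eq k μ ν a ha hμ hν hsum L]
    ring
  simp only [hterm] at h
  rw [← hadef, hsum]
  rw [show 4 * (-k ^ 2 / 4) = -k ^ 2 by ring] at h
  refine ⟨(summable_mul_left_iff hc0).mp h.summable, ?_⟩
  rw [← h.tsum_eq, tsum_mul_left]
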